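/- For $m\ge 0$ let $H_m=\sum_{j=1}^{m}\frac1j$ denote the $m$-th harmonic number (so $H_0=0$), and let $\Gamma$ denote the Gamma function. Then the series below converges, as the limit of its partial sums, and $$\sum_{k=0}^{\infty}\frac{\binom{2k}{k}^{2}}{(-16)^{k}}\,\bigl(2H_{2k}-H_{k}\bigr)=-\frac{\ln(2)\,\Gamma\left(\frac14\right)^{2}}{4\pi\sqrt{2\pi}} .$$ -/

import Mathlib

/-! Write `c k` for `centralBinomRatio k` and `h k` for `centralBinomHarmonic k`. Since `π * c k` is
the integral of `sin x ^ (2 * k)` over `[0, π]`, the partial sums are `π⁻¹` times integrals of `∑ h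
k * (-sin x ^ 2) ^ k`. The generating function of `h` is `-log (1 - t) / √(1 - t)`, and dominated
convergence (`abs_sum_centralBinomHarmonic_le`) passes to the limit. With `s = sin x` the limit
involves `log (1 + s ^ 2)` against the lemniscate measure `ds / √(1 - s ^ 4)` on `(0, 1)`. An
involution preserving this measure sends `log (1 + s ^ 2)` to `log 2 - log (1 + s ^ 2)`, so the
logarithm may be replaced by `log 2 / 2`. The total mass is a Beta value. -/

/-- Removing the head leaves `b 0 - S'`, where by induction `0 ≤ S' ≤ b 1 ≤ b 0`. -/
theorem abs_alternating_sum_le {b : ℕ → ℝ} (hb : Antitone b) (h0 : ∀ k, 0 ≤ b k) (n : ℕ) :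
    0 ≤ ∑ k ∈ Finset.range n, (-1) ^ k * b k ∧ ∑ k ∈ Finset.range n, (-1) ^ k * b k ≤ b 0 := by
  induction n generalizing b with
  | zero => simpa using h0 0
  | succ n ih =>
    obtain ⟨h1, h2⟩ := ih (b := fun k => b (k + 1)) (fun i j hij => hb (by lia)) (fun k => h0 _)
    have h3 := hb (Nat.zero_le 1)
    rw [Finset.sum_range_succ']
    simp only [pow_succ, mul_neg, mul_one, neg_mul, Finset.sum_neg_distrib, pow_zero, one_mul]
    simp only [zero_add] at h2
    constructor <;> linarith

theorem HasSum.of_eq_fun {f g : ℕ → ℝ} {x : ℝ} (h : ∀ k, f k = g k) (hf : HasSum f x) :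
    HasSum g x :=
  funext h ▸ hf

/-- The series for `D` and `t * D` are the shapes in which a recurrence for `(k + 1) * a (k + 1)`
becomes a differential equation. -/
theorem exists_hasDerivAt_tsum_pow {a : ℕ → ℝ} {M : ℝ} (ha : ∀ k, |a k| ≤ M) {t : ℝ}
    (ht : |t| < 1) :
    ∃ D, HasDerivAt (fun s : ℝ => ∑' k, a k * s ^ k) D t ∧
      HasSum (fun k : ℕ => (k + 1 : ℝ) * a (k + 1) * t ^ k) D ∧
      HasSum (fun k : ℕ => (k : ℝ) * a k * t ^ k) (t * D) := by
  -- An intermediate radius makes the differentiated series uniformly dominated near `t`.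
  obtain ⟨r, htr, hr1⟩ := exists_between ht
  have hr0 : 0 < r := (abs_nonneg t).trans_lt htr
  have hM : 0 ≤ M := (abs_nonneg _).trans (ha 0)
  have hu : Summable fun k : ℕ => M * (k * r ^ k) / r := by
    have := summable_pow_mul_geometric_of_norm_lt_one 1 (r := r)
      (by rwa [Real.norm_eq_abs, abs_of_pos hr0])
    simp only [pow_one] at this
    exact (this.mul_left M).div_const r
  have hbound : ∀ (k : ℕ) (y : ℝ), y ∈ Metric.ball (0 : ℝ) r →
      ‖a k * (k * y ^ (k - 1))‖ ≤ M * (k * r ^ k) / r := by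
    intro k y hy
    rw [mem_ball_zero_iff, Real.norm_eq_abs] at hy
    rcases k with _ | k
    · simp
    · rw [norm_mul, norm_mul, norm_pow, Real.norm_eq_abs, Real.norm_eq_abs, Real.norm_eq_abs,
        mul_div_assoc, mul_div_assoc, Nat.abs_cast, Nat.add_sub_cancel, pow_succ r,
        mul_div_cancel_right₀ _ hr0.ne']
      have := ha (k + 1)
      gcongr
  have hmem : t ∈ Metric.ball (0 : ℝ) r := by simpa using htr
  have hD := hasDerivAt_tsum_of_isPreconnected (g := fun k s => a k * s ^ k)
    (g' := fun k s => a k * (k * s ^ (k - 1))) hu Metric.isOpen_ball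
    (convex_ball (0 : ℝ) r).isPreconnected
    (fun k y _ => (hasDerivAt_pow k y).const_mul (a k)) hbound (y₀ := 0) (by simpa using hr0)
    (summable_of_ne_finset_zero (s := {0}) fun k hk => by
      have : k ≠ 0 := by simpa using hk
      simp [this]) hmem
  have hs : Summable fun k : ℕ => a k * (k * t ^ (k - 1)) :=
    Summable.of_norm_bounded hu fun k => hbound k t hmem
  refine ⟨_, hD, ?_, ?_⟩
  · have := (hasSum_nat_add_iff' 1).2 hs.hasSum
    simp only [Finset.range_one, Finset.sum_singleton, Nat.cast_zero, zero_mul, mul_zero,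
      sub_zero] at this
    refine HasSum.of_eq_fun (fun k => ?_) this
    push_cast
    ring
  · refine HasSum.of_eq_fun (fun k => ?_) (hs.hasSum.mul_left t)
    rcases k with _ | k
    · simp
    · rw [Nat.add_sub_cancel]
      ring

theorem summable_bounded_mul_pow {a : ℕ → ℝ} {M : ℝ} (ha : ∀ k, |a k| ≤ M) {t : ℝ}
    (ht : |t| < 1) : Summable fun k => a k * t ^ k := by
  refine Summable.of_norm_bounded ((summable_geometric_of_abs_lt_one
    (by rwa [abs_abs])).mul_left M) fun k => ?_
  rw [norm_mul, norm_pow, Real.norm_eq_abs, Real.norm_eq_abs]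
  gcongr
  exact ha k

/-! ### Coefficients: recurrences, monotonicity and bounds. -/

/-- The normalized central binomial coefficient, which is `(1/2)ₖ / k!`. -/
noncomputable def centralBinomRatio (k : ℕ) : ℝ := (2 * k).choose k / 4 ^ k

/-- The derivative of `(s)ₖ / k!` at `s = 1/2`. -/
noncomputable def centralBinomHarmonic (k : ℕ) : ℝ :=
  centralBinomRatio k * (2 * (harmonic (2 * k) : ℝ) - (harmonic k : ℝ))

theorem centralBinomRatio_succ (k : ℕ) :
    (k + 1) * centralBinomRatio (k + 1) = (k + 1 / 2) * centralBinomRatio k := by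
  have h : ((k + 1 : ℕ) : ℝ) * Nat.centralBinom (k + 1) = 2 * (2 * k + 1) * Nat.centralBinom k := by
    exact_mod_cast Nat.succ_mul_centralBinom_succ k
  rw [centralBinomRatio, centralBinomRatio, ← Nat.centralBinom_eq_two_mul_choose,
    ← Nat.centralBinom_eq_two_mul_choose, pow_succ]
  push_cast at h
  field_simp
  linarith

theorem centralBinomRatio_zero : centralBinomRatio 0 = 1 := by simp [centralBinomRatio]

theorem centralBinomRatio_nonneg (k : ℕ) : 0 ≤ centralBinomRatio k := by
  unfold centralBinomRatio
  positivity

theorem centralBinomRatio_eq_prod (n : ℕ) :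
    centralBinomRatio n = ∏ i ∈ Finset.range n, (2 * (i : ℝ) + 1) / (2 * i + 2) := by
  induction n with
  | zero => simp [centralBinomRatio]
  | succ n ih =>
    have := centralBinomRatio_succ n
    rw [Finset.prod_range_succ, ← ih]
    field_simp
    linarith

theorem two_mul_harmonic_sub_succ (k : ℕ) :
    2 * (harmonic (2 * (k + 1)) : ℝ) - (harmonic (k + 1) : ℝ) =
      2 * (harmonic (2 * k) : ℝ) - (harmonic k : ℝ) + 2 / (2 * k + 1) := by
  rw [mul_add, mul_one, harmonic_succ, harmonic_succ, harmonic_succ]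
  push_cast
  field_simp
  ring

theorem centralBinomHarmonic_succ (k : ℕ) :
    (k + 1) * centralBinomHarmonic (k + 1) =
      (k + 1 / 2) * centralBinomHarmonic k + centralBinomRatio k := by
  have h := centralBinomRatio_succ k
  unfold centralBinomHarmonic
  rw [two_mul_harmonic_sub_succ, ← mul_assoc, h]
  field_simp

theorem centralBinomHarmonic_zero : centralBinomHarmonic 0 = 0 := by simp [centralBinomHarmonic]

theorem centralBinomHarmonic_one : centralBinomHarmonic 1 = 1 := by
  have := centralBinomHarmonic_succ 0
  simpa [centralBinomHarmonic_zero, centralBinomRatio_zero] using this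

theorem two_le_two_mul_harmonic_sub (k : ℕ) :
    2 ≤ 2 * (harmonic (2 * (k + 1)) : ℝ) - (harmonic (k + 1) : ℝ) := by
  induction k with
  | zero => rw [two_mul_harmonic_sub_succ]; simp
  | succ k ih =>
    rw [two_mul_harmonic_sub_succ]
    have : (0 : ℝ) ≤ 2 / (2 * (k + 1 : ℕ) + 1) := by positivity
    linarith

theorem centralBinomHarmonic_nonneg (k : ℕ) : 0 ≤ centralBinomHarmonic k := by
  rcases k with _ | k
  · rw [centralBinomHarmonic_zero]
  · exact mul_nonneg (centralBinomRatio_nonneg _) (by linarith [two_le_two_mul_harmonic_sub k])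

/-- By the recurrence, decrease amounts to `2 * c k ≤ h k`, valid for `k ≥ 1`; the shift is needed
because `h 0 = 0 < h 1 = 1`. -/
theorem antitone_centralBinomHarmonic_succ :
    Antitone fun k : ℕ => centralBinomHarmonic (k + 1) := by
  refine antitone_nat_of_succ_le fun k => ?_
  have h := centralBinomHarmonic_succ (k + 1)
  have h2 : 2 * centralBinomRatio (k + 1) ≤ centralBinomHarmonic (k + 1) := by
    rw [mul_comm]
    exact mul_le_mul_of_nonneg_left (two_le_two_mul_harmonic_sub k) (centralBinomRatio_nonneg _)
  refine le_of_mul_le_mul_left (a := ((k + 1 : ℕ) : ℝ) + 1) ?_ (by positivity)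
  rw [h]
  linarith

theorem abs_centralBinomHarmonic_le (k : ℕ) : |centralBinomHarmonic k| ≤ 1 := by
  rw [abs_of_nonneg (centralBinomHarmonic_nonneg k)]
  rcases k with _ | k
  · simp [centralBinomHarmonic_zero]
  · simpa [centralBinomHarmonic_one] using antitone_centralBinomHarmonic_succ (Nat.zero_le k)

theorem abs_centralBinomRatio_le (k : ℕ) : |centralBinomRatio k| ≤ 1 := by
  rw [abs_of_nonneg (centralBinomRatio_nonneg k)]
  induction k with
  | zero => simp [centralBinomRatio_zero]
  | succ k ih =>
    have h := centralBinomRatio_succ k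
    refine le_of_mul_le_mul_left (a := (k : ℝ) + 1) ?_ (by positivity)
    rw [h]
    nlinarith

/-- The alternating signs give a bound uniform in `n` and `x`, up to `x = 1`. -/
theorem abs_sum_centralBinomHarmonic_le {x : ℝ} (h0 : 0 ≤ x) (h1 : x ≤ 1) (n : ℕ) :
    |∑ k ∈ Finset.range n, centralBinomHarmonic k * (-x) ^ k| ≤ 1 := by
  rcases n with _ | n
  · simp
  have hb : Antitone fun k : ℕ => centralBinomHarmonic (k + 1) * x ^ (k + 1) := by
    intro i j hij
    exact mul_le_mul (antitone_centralBinomHarmonic_succ hij)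
      (pow_le_pow_of_le_one h0 h1 (by lia)) (by positivity) (centralBinomHarmonic_nonneg _)
  obtain ⟨h2, h3⟩ := abs_alternating_sum_le hb
    (fun k => mul_nonneg (centralBinomHarmonic_nonneg _) (by positivity)) n
  have h4 : ∑ k ∈ Finset.range (n + 1), centralBinomHarmonic k * (-x) ^ k =
      -∑ k ∈ Finset.range n, (-1) ^ k * (centralBinomHarmonic (k + 1) * x ^ (k + 1)) := by
    rw [Finset.sum_range_succ', centralBinomHarmonic_zero, zero_mul, add_zero,
      ← Finset.sum_neg_distrib]
    refine Finset.sum_congr rfl fun k _ => ?_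
    rw [neg_pow x (k + 1)]
    ring
  rw [h4, abs_neg, abs_of_nonneg h2]
  simp only [zero_add, centralBinomHarmonic_one, one_mul, pow_one] at h3
  exact h3.trans h1

/-! ### Closed forms of the generating functions. -/

theorem eq_of_hasDerivAt_zero {f : ℝ → ℝ}
    (hf : ∀ t : ℝ, |t| < 1 → HasDerivAt f 0 t) {t : ℝ} (ht : |t| < 1) : f t = f 0 := by
  refine (Metric.isOpen_ball (x := (0 : ℝ)) (ε := 1)).is_const_of_deriv_eq_zero
    (convex_ball (0 : ℝ) 1).isPreconnected
    (fun s hs => (hf s (by simpa using hs)).differentiableAt.differentiableWithinAt)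
    (fun s hs => (hf s (by simpa using hs)).deriv) (by simpa using ht) (by simp)

theorem hasDerivAt_sqrt_one_sub {t : ℝ} (ht : |t| < 1) :
    HasDerivAt (fun s : ℝ => √(1 - s)) (-1 / (2 * √(1 - t))) t := by
  have h : 0 < 1 - t := by linarith [(abs_lt.1 ht).2]
  exact ((hasDerivAt_id t).const_sub 1).sqrt h.ne'

/-- The recurrence reads `(1 - t) * f' = f / 2`, so `√(1 - t) * f` is constant. -/
theorem hasSum_centralBinomRatio {t : ℝ} (ht : |t| < 1) :
    HasSum (fun k => centralBinomRatio k * t ^ k) (1 / √(1 - t)) := by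
  have hs : ∀ s : ℝ, |s| < 1 → Summable fun k => centralBinomRatio k * s ^ k :=
    fun s hs => summable_bounded_mul_pow abs_centralBinomRatio_le hs
  have key : ∀ s : ℝ, |s| < 1 →
      HasDerivAt (fun s : ℝ => √(1 - s) * ∑' k, centralBinomRatio k * s ^ k) 0 s := by
    intro s hs1
    obtain ⟨D, hD, h1, h2⟩ := exists_hasDerivAt_tsum_pow abs_centralBinomRatio_le hs1
    have hode : D = s * D + 1 / 2 * ∑' k, centralBinomRatio k * s ^ k := by
      refine h1.unique ?_
      refine HasSum.of_eq_fun (fun k => ?_) (h2.add ((hs s hs1).hasSum.mul_left (1 / 2)))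
      rw [centralBinomRatio_succ]
      ring
    have h : 0 < 1 - s := by linarith [(abs_lt.1 hs1).2]
    refine ((hasDerivAt_sqrt_one_sub hs1).mul hD).congr_deriv ?_
    have hq : √(1 - s) ^ 2 = 1 - s := Real.sq_sqrt h.le
    have hq0 : 0 < √(1 - s) := Real.sqrt_pos.2 h
    field_simp
    rw [hq]
    linarith
  have h := eq_of_hasDerivAt_zero key ht
  have hz : ∑' k, centralBinomRatio k * (0 : ℝ) ^ k = 1 := by
    rw [tsum_eq_single 0 fun k hk => by simp [hk]]
    simp [centralBinomRatio_zero]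
  have hq0 : 0 < √(1 - t) := Real.sqrt_pos.2 (by linarith [(abs_lt.1 ht).2])
  simp only [hz, sub_zero, Real.sqrt_one, mul_one] at h
  rw [← (eq_div_iff_mul_eq hq0.ne').2 ((mul_comm _ _).trans h)]
  exact (hs t ht).hasSum

/-- Here `(1 - t) * f' = f / 2 + 1 / √(1 - t)`, so `√(1 - t) * f + log (1 - t)` is constant. -/
theorem hasSum_centralBinomHarmonic {t : ℝ} (ht : |t| < 1) :
    HasSum (fun k => centralBinomHarmonic k * t ^ k) (-Real.log (1 - t) / √(1 - t)) := by
  have hs : ∀ s : ℝ, |s| < 1 → Summable fun k => centralBinomHarmonic k * s ^ k :=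
    fun s hs => summable_bounded_mul_pow abs_centralBinomHarmonic_le hs
  have key : ∀ s : ℝ, |s| < 1 →
      HasDerivAt (fun s : ℝ => √(1 - s) * (∑' k, centralBinomHarmonic k * s ^ k) +
        Real.log (1 - s)) 0 s := by
    intro s hs1
    obtain ⟨D, hD, h1, h2⟩ := exists_hasDerivAt_tsum_pow abs_centralBinomHarmonic_le hs1
    have hode : D = s * D + 1 / 2 * (∑' k, centralBinomHarmonic k * s ^ k) + 1 / √(1 - s) := by
      refine h1.unique ?_
      refine HasSum.of_eq_fun (fun k => ?_) ((h2.add ((hs s hs1).hasSum.mul_left (1 / 2))).add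
        (hasSum_centralBinomRatio hs1))
      rw [centralBinomHarmonic_succ]
      ring
    have h : 0 < 1 - s := by linarith [(abs_lt.1 hs1).2]
    refine (((hasDerivAt_sqrt_one_sub hs1).mul hD).add
      (((hasDerivAt_id s).const_sub 1).log h.ne')).congr_deriv ?_
    have hq : √(1 - s) ^ 2 = 1 - s := Real.sq_sqrt h.le
    have hq0 : 0 < √(1 - s) := Real.sqrt_pos.2 h
    have hD' : D * √(1 - s) ^ 2 =
        1 / 2 * (∑' k, centralBinomHarmonic k * s ^ k) + 1 / √(1 - s) := by
      rw [hq]; linarith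
    simp only [id]
    rw [show -1 / (1 - s) = -1 / √(1 - s) ^ 2 by rw [hq]]
    field_simp at hD' ⊢
    linarith
  have h := eq_of_hasDerivAt_zero key ht
  have hz : ∑' k, centralBinomHarmonic k * (0 : ℝ) ^ k = 0 := by
    rw [tsum_eq_single 0 fun k hk => by simp [hk]]
    simp [centralBinomHarmonic_zero]
  have hq0 : 0 < √(1 - t) := Real.sqrt_pos.2 (by linarith [(abs_lt.1 ht).2])
  simp only [hz, sub_zero, mul_zero, Real.log_one, add_zero] at h
  have h' : -Real.log (1 - t) / √(1 - t) = ∑' k, centralBinomHarmonic k * t ^ k := by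
    rw [div_eq_iff hq0.ne']
    linarith
  rw [h']
  exact (hs t ht).hasSum
-- Lemniscate integrals.
open MeasureTheory

theorem image_sin_Ioo : Real.sin '' Set.Ioo 0 (Real.pi / 2) = Set.Ioo 0 1 := by
  ext s
  constructor
  · rintro ⟨x, hx, rfl⟩
    refine ⟨Real.sin_pos_of_pos_of_lt_pi hx.1 (by linarith [hx.2, Real.pi_pos]), ?_⟩
    have := Real.sin_lt_sin_of_lt_of_le_pi_div_two (by linarith [hx.1, Real.pi_pos]) le_rfl hx.2
    simpa using this
  · intro hs
    exact ⟨Real.arcsin s, ⟨Real.arcsin_pos.2 hs.1, Real.arcsin_lt_pi_div_two.2 hs.2⟩,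
      Real.sin_arcsin (by linarith [hs.1]) hs.2.le⟩

theorem setIntegral_sin_substitution (g : ℝ → ℝ) :
    ∫ x in Set.Ioo 0 (Real.pi / 2), g (Real.sin x) / √(1 + Real.sin x ^ 2) =
      ∫ s in Set.Ioo (0 : ℝ) 1, g s / √(1 - s ^ 4) := by
  have hinj : Set.InjOn Real.sin (Set.Ioo 0 (Real.pi / 2)) :=
    Real.injOn_sin.mono (Set.Ioo_subset_Icc_self.trans
      (Set.Icc_subset_Icc_left (by linarith [Real.pi_pos])))
  rw [← image_sin_Ioo, integral_image_eq_integral_abs_deriv_smul measurableSet_Ioo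
    (fun x _ => (Real.hasDerivAt_sin x).hasDerivWithinAt)
    hinj]
  refine setIntegral_congr_fun measurableSet_Ioo fun x hx => ?_
  have hc : 0 < Real.cos x := Real.cos_pos_of_mem_Ioo ⟨by linarith [hx.1, Real.pi_pos], hx.2⟩
  have h : 1 - Real.sin x ^ 4 = Real.cos x ^ 2 * (1 + Real.sin x ^ 2) := by
    rw [Real.cos_sq']; ring
  simp only [smul_eq_mul]
  rw [h, Real.sqrt_mul (sq_nonneg _), Real.sqrt_sq hc.le, abs_of_pos hc]
  field_simp

/-- The involution of `(0, 1)` which preserves the measure `ds / √(1 - s ^ 4)`. -/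
noncomputable def lemniscateInvolution (s : ℝ) : ℝ := √((1 - s ^ 2) / (1 + s ^ 2))

theorem lemniscateInvolution_sq {s : ℝ} (hs : s ∈ Set.Ioo (0 : ℝ) 1) :
    lemniscateInvolution s ^ 2 = (1 - s ^ 2) / (1 + s ^ 2) := by
  have : 0 < 1 - s ^ 2 := by nlinarith [hs.1, hs.2]
  exact Real.sq_sqrt (by positivity)

theorem lemniscateInvolution_mem {s : ℝ} (hs : s ∈ Set.Ioo (0 : ℝ) 1) :
    lemniscateInvolution s ∈ Set.Ioo (0 : ℝ) 1 := by
  have h1 : 0 < 1 - s ^ 2 := by nlinarith [hs.1, hs.2]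
  have h2 : 0 < s ^ 2 := pow_pos hs.1 2
  refine ⟨Real.sqrt_pos.2 (by positivity), ?_⟩
  rw [lemniscateInvolution, Real.sqrt_lt' one_pos, div_lt_iff₀ (by positivity)]
  linarith

theorem lemniscateInvolution_involutive {s : ℝ} (hs : s ∈ Set.Ioo (0 : ℝ) 1) :
    lemniscateInvolution (lemniscateInvolution s) = s := by
  have h : (1 - (1 - s ^ 2) / (1 + s ^ 2)) / (1 + (1 - s ^ 2) / (1 + s ^ 2)) = s ^ 2 := by
    have : 0 < 1 + s ^ 2 := by positivity
    field_simp
    ring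
  rw [lemniscateInvolution, lemniscateInvolution_sq hs, h, Real.sqrt_sq hs.1.le]

theorem image_lemniscateInvolution : lemniscateInvolution '' Set.Ioo 0 1 = Set.Ioo 0 1 := by
  ext s
  constructor
  · rintro ⟨x, hx, rfl⟩
    exact lemniscateInvolution_mem hx
  · intro hs
    exact ⟨_, lemniscateInvolution_mem hs, lemniscateInvolution_involutive hs⟩

theorem hasDerivAt_lemniscateInvolution {s : ℝ} (hs : s ∈ Set.Ioo (0 : ℝ) 1) :
    HasDerivAt lemniscateInvolution
      (-(2 * s) / ((1 + s ^ 2) ^ 2 * lemniscateInvolution s)) s := by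
  have h1 : 0 < 1 - s ^ 2 := by nlinarith [hs.1, hs.2]
  have h2 : 0 < 1 + s ^ 2 := by positivity
  have h := (((hasDerivAt_pow 2 s).const_sub 1).div ((hasDerivAt_pow 2 s).const_add 1)
    h2.ne').sqrt (div_pos h1 h2).ne'
  have hpos := (lemniscateInvolution_mem hs).1
  refine h.congr_deriv ?_
  change _ / (2 * lemniscateInvolution s) = _
  field_simp
  push_cast
  ring

theorem setIntegral_lemniscateInvolution (g : ℝ → ℝ) :
    ∫ s in Set.Ioo (0 : ℝ) 1, g s / √(1 - s ^ 4) =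
      ∫ s in Set.Ioo (0 : ℝ) 1, g (lemniscateInvolution s) / √(1 - s ^ 4) := by
  conv_lhs => rw [← image_lemniscateInvolution]
  rw [integral_image_eq_integral_abs_deriv_smul measurableSet_Ioo
    (fun x hx => (hasDerivAt_lemniscateInvolution hx).hasDerivWithinAt)
    (Set.LeftInvOn.injOn (f₁' := lemniscateInvolution)
      fun x hx => lemniscateInvolution_involutive hx)]
  refine setIntegral_congr_fun measurableSet_Ioo fun s hs => ?_
  have h1 : 0 < 1 - s ^ 2 := by nlinarith [hs.1, hs.2]
  have h2 : 0 < 1 + s ^ 2 := by positivity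
  have h0 := hs.1
  have hpos := (lemniscateInvolution_mem hs).1
  have hsq := lemniscateInvolution_sq hs
  have e1 : √(1 - lemniscateInvolution s ^ 4) = 2 * s / (1 + s ^ 2) := by
    rw [Real.sqrt_eq_iff_eq_sq]
    · rw [show lemniscateInvolution s ^ 4 = (lemniscateInvolution s ^ 2) ^ 2 by ring, hsq]
      field_simp
      ring
    · rw [sub_nonneg]
      exact pow_le_one₀ hpos.le (lemniscateInvolution_mem hs).2.le
    · positivity
  have e2 : √(1 - s ^ 4) = (1 + s ^ 2) * lemniscateInvolution s := by
    rw [Real.sqrt_eq_iff_eq_sq]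
    · rw [mul_pow, hsq]
      field_simp
      ring
    · nlinarith
    · positivity
  simp only [smul_eq_mul]
  rw [e1, e2, neg_div, abs_neg, abs_of_pos (by positivity)]
  field_simp

theorem log_one_add_lemniscateInvolution_sq {s : ℝ} (hs : s ∈ Set.Ioo (0 : ℝ) 1) :
    Real.log (1 + lemniscateInvolution s ^ 2) = Real.log 2 - Real.log (1 + s ^ 2) := by
  have h2 : 0 < 1 + s ^ 2 := by positivity
  rw [lemniscateInvolution_sq hs, ← Real.log_div two_ne_zero h2.ne']
  congr 1
  field_simp
  ring

/-- The involution changes the sign of the integrand's numerator, so the integral equals its own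
negative. -/
theorem setIntegral_log_sub_eq_zero :
    ∫ s in Set.Ioo (0 : ℝ) 1, (Real.log (1 + s ^ 2) - Real.log 2 / 2) / √(1 - s ^ 4) = 0 := by
  have h := setIntegral_lemniscateInvolution fun s => Real.log (1 + s ^ 2) - Real.log 2 / 2
  have h' : ∫ s in Set.Ioo (0 : ℝ) 1,
        (Real.log (1 + lemniscateInvolution s ^ 2) - Real.log 2 / 2) / √(1 - s ^ 4) =
      -∫ s in Set.Ioo (0 : ℝ) 1, (Real.log (1 + s ^ 2) - Real.log 2 / 2) / √(1 - s ^ 4) := by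
    rw [← integral_neg]
    refine setIntegral_congr_fun measurableSet_Ioo fun s hs => ?_
    rw [log_one_add_lemniscateInvolution_sq hs]
    ring
  linarith

theorem image_pow_four_Ioo : (fun s : ℝ => s ^ 4) '' Set.Ioo 0 1 = Set.Ioo 0 1 := by
  ext u
  constructor
  · rintro ⟨x, hx, rfl⟩
    exact ⟨pow_pos hx.1 4, pow_lt_one₀ hx.1.le hx.2 (by norm_num)⟩
  · intro hu
    refine ⟨√√u, ⟨by simpa using hu.1, ?_⟩, ?_⟩
    · rw [Real.sqrt_lt' one_pos, Real.sqrt_lt' (by norm_num)]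
      simpa using hu.2
    · change √√u ^ 4 = u
      rw [show √√u ^ 4 = (√√u ^ 2) ^ 2 by ring, Real.sq_sqrt (Real.sqrt_nonneg _),
        Real.sq_sqrt hu.1.le]

theorem setIntegral_beta_eq (a b : ℝ) (ha : 0 < a) (hb : 0 < b) :
    ∫ u in Set.Ioo (0 : ℝ) 1, u ^ (a - 1) * (1 - u) ^ (b - 1) = ProbabilityTheory.beta a b := by
  rw [ProbabilityTheory.beta_eq_betaIntegralReal a b ha hb, Complex.betaIntegral,
    intervalIntegral.integral_of_le zero_le_one, integral_Ioc_eq_integral_Ioo,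
    ← Complex.ofReal_re (∫ u in Set.Ioo (0 : ℝ) 1, u ^ (a - 1) * (1 - u) ^ (b - 1))]
  congr 1
  rw [← integral_complex_ofReal]
  refine setIntegral_congr_fun measurableSet_Ioo fun u hu => ?_
  rw [Complex.ofReal_mul, Complex.ofReal_cpow hu.1.le, Complex.ofReal_cpow (by linarith [hu.2])]
  push_cast
  rfl

/-- Substitute `u = s ^ 4`. -/
theorem beta_one_fourth_one_half :
    ProbabilityTheory.beta (1 / 4) (1 / 2) =
      4 * ∫ s in Set.Ioo (0 : ℝ) 1, 1 / √(1 - s ^ 4) := by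
  rw [← setIntegral_beta_eq _ _ (by norm_num) (by norm_num), ← image_pow_four_Ioo,
    integral_image_eq_integral_abs_deriv_smul measurableSet_Ioo
      (fun x _ => (hasDerivAt_pow 4 x).hasDerivWithinAt)
      (fun x hx y hy h => (pow_left_inj₀ hx.1.le hy.1.le (by norm_num)).1 h), image_pow_four_Ioo,
    ← integral_const_mul]
  refine setIntegral_congr_fun measurableSet_Ioo fun s hs => ?_
  have h0 := hs.1
  have h4 : 0 < 1 - s ^ 4 := by
    have := pow_lt_one₀ hs.1.le hs.2 (n := 4) (by norm_num)
    linarith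
  have e1 : (s ^ 4) ^ ((1 : ℝ) / 4 - 1) = (s ^ 3)⁻¹ := by
    rw [← Real.rpow_natCast s 4, ← Real.rpow_mul h0.le, ← Real.rpow_natCast s 3,
      ← Real.rpow_neg h0.le]
    norm_num
  have e2 : (1 - s ^ 4) ^ ((1 : ℝ) / 2 - 1) = (√(1 - s ^ 4))⁻¹ := by
    rw [Real.sqrt_eq_rpow, ← Real.rpow_neg h4.le]
    norm_num
  simp only [smul_eq_mul]
  rw [e1, e2, abs_of_pos (by positivity)]
  norm_num
  field_simp

theorem setIntegral_lemniscate :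
    ∫ s in Set.Ioo (0 : ℝ) 1, 1 / √(1 - s ^ 4) =
      Real.Gamma (1 / 4) ^ 2 / (4 * √(2 * Real.pi)) := by
  have h := beta_one_fourth_one_half
  -- The reflection formula eliminates `Γ(3/4)` from the Beta value.
  have hr := Real.Gamma_mul_Gamma_one_sub (1 / 4)
  rw [mul_one_div, Real.sin_pi_div_four] at hr
  rw [ProbabilityTheory.beta, Real.Gamma_one_half_eq] at h
  rw [show (1 : ℝ) - 1 / 4 = 3 / 4 by norm_num] at hr
  rw [show (1 : ℝ) / 4 + 1 / 2 = 3 / 4 by norm_num] at h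
  have hg : 0 < Real.Gamma (1 / 4) := Real.Gamma_pos_of_pos (by norm_num)
  have hg' : Real.Gamma (3 / 4) = √2 * Real.pi / Real.Gamma (1 / 4) := by
    rw [eq_div_iff hg.ne', mul_comm, hr]
    field_simp
    norm_num
  have hp := Real.pi_pos
  rw [hg'] at h
  rw [Real.sqrt_mul zero_le_two, ← mul_right_inj' (four_ne_zero (α := ℝ)), ← h]
  field_simp
  rw [Real.sq_sqrt hp.le]

/-! ### Evaluation of the integral and passage to the limit. -/

theorem integral_sin_symm {F : ℝ → ℝ} (hF : Continuous fun x => F (Real.sin x)) :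
    ∫ x in (0 : ℝ)..Real.pi, F (Real.sin x) =
      2 * ∫ x in Set.Ioo 0 (Real.pi / 2), F (Real.sin x) := by
  have h := intervalIntegral.integral_comp_sub_left (a := 0) (b := Real.pi / 2)
    (fun x => F (Real.sin x)) Real.pi
  simp only [Real.sin_pi_sub, sub_zero] at h
  rw [show Real.pi - Real.pi / 2 = Real.pi / 2 by ring] at h
  rw [← intervalIntegral.integral_add_adjacent_intervals
    (hF.intervalIntegrable 0 (Real.pi / 2)) (hF.intervalIntegrable (Real.pi / 2) Real.pi), ← h,
    ← integral_Ioc_eq_integral_Ioo, ← intervalIntegral.integral_of_le Real.pi_div_two_pos.le]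
  ring

theorem integral_log_one_add_sin_sq :
    ∫ x in (0 : ℝ)..Real.pi, -Real.log (1 + Real.sin x ^ 2) / √(1 + Real.sin x ^ 2) =
      -(Real.log 2 * Real.Gamma (1 / 4) ^ 2 / (4 * √(2 * Real.pi))) := by
  have hpos : ∀ x : ℝ, 0 < 1 + Real.sin x ^ 2 := fun x => by positivity
  have hc1 : Continuous fun x : ℝ => -Real.log (1 + Real.sin x ^ 2) / √(1 + Real.sin x ^ 2) :=
    ((Continuous.log (by fun_prop) fun x => (hpos x).ne').neg).div (by fun_prop)
      fun x => (Real.sqrt_pos.2 (hpos x)).ne'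
  have hc2 : Continuous fun x : ℝ => 1 / √(1 + Real.sin x ^ 2) :=
    continuous_const.div (by fun_prop) fun x => (Real.sqrt_pos.2 (hpos x)).ne'
  have hint : ∀ {f : ℝ → ℝ}, Continuous f →
      IntegrableOn f (Set.Ioo 0 (Real.pi / 2)) := fun hf =>
    (hf.integrableOn_Icc).mono_set Set.Ioo_subset_Icc_self
  have h1 := setIntegral_sin_substitution fun s => Real.log (1 + s ^ 2) - Real.log 2 / 2
  rw [setIntegral_log_sub_eq_zero] at h1
  have h2 := (setIntegral_sin_substitution fun _ => 1).trans setIntegral_lemniscate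
  have h3 : ∫ x in Set.Ioo 0 (Real.pi / 2),
      (Real.log (1 + Real.sin x ^ 2) - Real.log 2 / 2) / √(1 + Real.sin x ^ 2) =
      -(∫ x in Set.Ioo 0 (Real.pi / 2),
        -Real.log (1 + Real.sin x ^ 2) / √(1 + Real.sin x ^ 2)) -
      Real.log 2 / 2 * ∫ x in Set.Ioo 0 (Real.pi / 2), 1 / √(1 + Real.sin x ^ 2) := by
    rw [← integral_neg, ← integral_const_mul]
    refine Eq.trans ?_ (integral_sub (hint hc1.neg) ((hint hc2).const_mul _))
    refine integral_congr_ae (Filter.Eventually.of_forall fun x => ?_)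
    simp only
    ring
  rw [integral_sin_symm (F := fun s => -Real.log (1 + s ^ 2) / √(1 + s ^ 2)) hc1]
  rw [h3, h2] at h1
  have h4 : ∫ x in Set.Ioo 0 (Real.pi / 2),
      -Real.log (1 + Real.sin x ^ 2) / √(1 + Real.sin x ^ 2) =
      -(Real.log 2 / 2 * (Real.Gamma (1 / 4) ^ 2 / (4 * √(2 * Real.pi)))) := by linarith
  rw [h4]
  ring

theorem sum_eq_integral_sin (n : ℕ) :
    ∑ k ∈ Finset.range n, (((2 * k).choose k : ℝ) ^ 2 / (-16 : ℝ) ^ k) *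
        (2 * (harmonic (2 * k) : ℝ) - (harmonic k : ℝ)) =
      Real.pi⁻¹ * ∫ x in (0 : ℝ)..Real.pi,
        ∑ k ∈ Finset.range n, centralBinomHarmonic k * (-Real.sin x ^ 2) ^ k := by
  rw [intervalIntegral.integral_finsetSum fun k _ =>
    Continuous.intervalIntegrable (by fun_prop) _ _, Finset.mul_sum]
  refine Finset.sum_congr rfl fun k _ => ?_
  have h : ∫ x in (0 : ℝ)..Real.pi, centralBinomHarmonic k * (-Real.sin x ^ 2) ^ k =
      centralBinomHarmonic k * (-1) ^ k * (Real.pi * centralBinomRatio k) := by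
    rw [centralBinomRatio_eq_prod, ← integral_sin_pow_even, ← intervalIntegral.integral_const_mul]
    refine intervalIntegral.integral_congr fun x _ => ?_
    rw [neg_pow, ← pow_mul, mul_assoc]
  have hp := Real.pi_pos
  rw [h, centralBinomHarmonic, centralBinomRatio,
    show (-16 : ℝ) ^ k = (-1) ^ k * (4 ^ k * 4 ^ k) by rw [← mul_pow, ← mul_pow]; norm_num]
  have h1 : ((-1 : ℝ) ^ k) * (-1) ^ k = 1 := by rw [← mul_pow]; norm_num
  have h2 : ((-1 : ℝ) ^ k) ≠ 0 := by positivity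
  field_simp
  linear_combination (-((2 * k).choose k : ℝ) ^ 2 *
    (2 * (harmonic (2 * k) : ℝ) - (harmonic k : ℝ))) * h1

theorem mainTheorem3 :
    Filter.Tendsto
      (fun n : ℕ => ∑ k ∈ Finset.range n,
        (((2 * k).choose k : ℝ) ^ 2 / (-16 : ℝ) ^ k) *
          (2 * (harmonic (2 * k) : ℝ) - (harmonic k : ℝ)))
      Filter.atTop
      (nhds (-(Real.log 2 * Real.Gamma (1 / 4) ^ 2 /
        (4 * Real.pi * Real.sqrt (2 * Real.pi))))) := by
  simp_rw [sum_eq_integral_sin]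
  rw [show -(Real.log 2 * Real.Gamma (1 / 4) ^ 2 / (4 * Real.pi * √(2 * Real.pi))) =
    Real.pi⁻¹ * -(Real.log 2 * Real.Gamma (1 / 4) ^ 2 / (4 * √(2 * Real.pi))) by
      have hp := Real.pi_pos
      field_simp, ← integral_log_one_add_sin_sq]
  refine Filter.Tendsto.const_mul _ ?_
  refine intervalIntegral.tendsto_integral_filter_of_dominated_convergence (fun _ => 1)
    (Filter.Eventually.of_forall fun n => Continuous.aestronglyMeasurable (by fun_prop))
    (Filter.Eventually.of_forall fun n => Filter.Eventually.of_forall fun x _ =>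
      abs_sum_centralBinomHarmonic_le (sq_nonneg _) (Real.sin_sq_le_one x) n)
    intervalIntegrable_const ?_
  -- At `π / 2` the argument is `-1`, outside the open disc where the closed form is known.
  have hne : ∀ᵐ x : ℝ, x ≠ Real.pi / 2 := by
    simp [ae_iff]
  filter_upwards [hne] with x hx hmem
  rw [Set.uIoc_of_le Real.pi_pos.le] at hmem
  have hcos : Real.cos x ≠ 0 := fun h => hx <| Real.injOn_cos ⟨hmem.1.le, hmem.2⟩
    ⟨by linarith [Real.pi_pos], by linarith [Real.pi_pos]⟩ (h.trans Real.cos_pi_div_two.symm)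
  have hlt : |-Real.sin x ^ 2| < 1 := by
    rw [abs_neg, abs_of_nonneg (sq_nonneg _), Real.sin_sq]
    have := pow_pos (abs_pos.2 hcos) 2
    rw [sq_abs] at this
    linarith
  have h := (hasSum_centralBinomHarmonic hlt).tendsto_sum_nat
  rwa [sub_neg_eq_add] at h
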